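/- Let $\alpha_0,\alpha_1\in(-1,1)$, $\beta_0,\beta_1\in\mathbb R$, $\sigma>0$ and $\rho\in(-1,1)$. On a probability space, let $X_1$ be a real random variable whose law $\nu$ has finite moments of all orders, and let $((\varepsilon_{2n},\varepsilon_{2n+1}))_{n\ge1}$ be an i.i.d. sequence, independent of $X_1$, of centered bivariate Gaussian vectors with covariance matrix $\sigma^2\begin{pmatrix}1&\rho\\ \rho&1\end{pmatrix}$. Let $(X_n)_{n\ge1}$ follow the bifurcating autoregressive (BAR) model: for all $n\ge1$, $$X_{2n}=\alpha_0X_n+\beta_0+\varepsilon_{2n},\qquad X_{2n+1}=\alpha_1X_n+\beta_1+\varepsilon_{2n+1}.$$ For $r\ge0$ let $\mathbb T_r=\{1,2,\dots,2^{r+1}-1\}$ be the first $r+1$ generations of the binary tree. Let $\hat\theta^r=(\hat\alpha_0^r,\hat\beta_0^r,\hat\alpha_1^r,\hat\beta_1^r)$ be the least squares (equivalently, maximum likelihood) estimator of $\theta=(\alpha_0,\beta_0,\alpha_1,\beta_1)$ based on the observation of $(X_i)_{i\in\mathbb T_{r+1}}$, that is, for $e\in\{0,1\}$, $$\hat\alpha_e^r=\frac{|\mathbb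 T_r|^{-1}\sum_{i\in\mathbb T_r}X_iX_{2i+e}-\bigl(|\mathbb T_r|^{-1}\sum_{i\in\mathbb T_r}X_i\bigr)\bigl(|\mathbb T_r|^{-1}\sum_{i\in\mathbb T_r}X_{2i+e}\bigr)}{|\mathbb T_r|^{-1}\sum_{i\in\mathbb T_r}X_i^2-\bigl(|\mathbb T_r|^{-1}\sum_{i\in\mathbb T_r}X_i\bigr)^2},$$ $$\hat\beta_e^r=|\mathbb T_r|^{-1}\sum_{i\in\mathbb T_r}X_{2i+e}-\hat\alpha_e^r\,|\mathbb T_r|^{-1}\sum_{i\in\mathbb T_r}X_i$$ (with an arbitrary convention, here $\hat\alpha_e^r=0$, when the denominator vanishes, as it does for $r=0$). Then $(\hat\theta^r)_{r\ge0}$ is a strongly consistent estimator of $\theta$: almost surely, $\hat\theta^r\to\theta$ as $r\to\infty$. -/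

import Mathlib

open MeasureTheory ProbabilityTheory Filter Topology
open scoped BigOperators

namespace BAR

/-- The `q`-th generation `{2 ^ q, …, 2 ^ (q + 1) - 1}` of the binary tree on the positive
integers, in which the daughters of `n` are `2 n` and `2 n + 1` and the root is `1`. -/
def gen (q : ℕ) : Finset ℕ := Finset.Ico (2 ^ q) (2 ^ (q + 1))

/-- The subtree made of the generations `0, …, r`. -/
def tree (r : ℕ) : Finset ℕ := (Finset.range (r + 1)).biUnion gen

/-- The empirical average of `f` over the subtree `tree r`. -/
noncomputable def avg (r : ℕ) (f : ℕ → ℝ) : ℝ := ((tree r).card : ℝ)⁻¹ * ∑ i ∈ tree r, f i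

/-- Slope estimator computed from the observations `x i`, `i ∈ tree (r + 1)`, for the new-pole
daughters (`e = 0`) or the old-pole daughters (`e = 1`). -/
noncomputable def alphaHat (x : ℕ → ℝ) (e r : ℕ) : ℝ :=
  (avg r (fun i => x i * x (2 * i + e)) - avg r x * avg r (fun i => x (2 * i + e))) /
    (avg r (fun i => x i ^ 2) - avg r x ^ 2)

/-- Intercept estimator computed from the observations `x i`, `i ∈ tree (r + 1)`, for the new-pole
daughters (`e = 0`) or the old-pole daughters (`e = 1`). -/
noncomputable def betaHat (x : ℕ → ℝ) (e r : ℕ) : ℝ :=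
  avg r (fun i => x (2 * i + e)) - alphaHat x e r * avg r x

/-- The closed-form estimator is a least squares estimator: it minimizes the residual sum of
squares of the regression of the daughters on their mothers. -/
theorem alphaHat_betaHat_leastSquares (x : ℕ → ℝ) (e r : ℕ) (a b : ℝ) :
    ∑ i ∈ tree r, (x (2 * i + e) - alphaHat x e r * x i - betaHat x e r) ^ 2 ≤
      ∑ i ∈ tree r, (x (2 * i + e) - a * x i - b) ^ 2 := by
  have hc : (0:ℝ) < (tree r).card := by
    have : 1 ∈ tree r := by simp [tree, gen]; exact ⟨0, by simp⟩
    exact_mod_cast Finset.card_pos.mpr ⟨1, this⟩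
  set N : ℝ := ((tree r).card : ℝ) with hN
  have ex : ∀ a b : ℝ, ∑ i ∈ tree r, (x (2 * i + e) - a * x i - b) ^ 2 =
      N * (avg r (fun i => x (2*i+e)^2) - 2*a*avg r (fun i => x i * x (2*i+e)) - 2*b*avg r (fun i => x (2*i+e))
        + a^2 * avg r (fun i => x i^2) + 2*a*b*avg r x + b^2) := by
    intro a b
    have : ∑ i ∈ tree r, (x (2 * i + e) - a * x i - b) ^ 2 = ∑ i ∈ tree r, x (2*i+e)^2
       - 2*a*∑ i ∈ tree r, x i * x (2*i+e) - 2*b*∑ i ∈ tree r, x (2*i+e) + a^2*∑ i ∈ tree r, x i^2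
       + 2*a*b*∑ i ∈ tree r, x i + b^2*N := by
      have h1 : b^2 * N = ∑ i ∈ tree r, b^2 := by simp [hN, mul_comm]
      rw [h1]
      simp only [Finset.mul_sum, ← Finset.sum_add_distrib, ← Finset.sum_sub_distrib]
      exact Finset.sum_congr rfl fun i _ => by ring
    rw [this]; unfold avg; rw [← hN]; field_simp
  rw [ex, ex]
  have hq : ∀ a b : ℝ, 0 ≤ avg r (fun i => x (2*i+e)^2) - 2*a*avg r (fun i => x i * x (2*i+e)) - 2*b*avg r (fun i => x (2*i+e))
        + a^2 * avg r (fun i => x i^2) + 2*a*b*avg r x + b^2 := by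
    intro a b
    have := ex a b
    have h2 : 0 ≤ ∑ i ∈ tree r, (x (2 * i + e) - a * x i - b) ^ 2 := Finset.sum_nonneg fun i _ => sq_nonneg _
    rw [this] at h2
    exact nonneg_of_mul_nonneg_right h2 hc
  apply mul_le_mul_of_nonneg_left _ hc.le
  unfold betaHat
  set A := alphaHat x e r with hA
  unfold alphaHat at hA
  set m := avg r x
  set s := avg r (fun i => x i^2)
  set p := avg r (fun i => x i * x (2*i+e))
  set l := avg r (fun i => x (2*i+e))
  set t := avg r (fun i => x (2*i+e)^2)
  have hD : ∀ a, 0 ≤ t - l^2 - 2*a*(p - m*l) + a^2*(s-m^2) := fun a => by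
    have := hq a (l - a*m); nlinarith
  have hk : A * (s - m ^ 2) = p - m * l := by
    by_cases h : s - m ^ 2 = 0
    · rw [h] at hD ⊢
      by_contra hne
      have hne : p - m * l ≠ 0 := fun h => hne (by simp [h])
      have h1 := hD ((t - l ^ 2 + 1) / (2 * (p - m * l)))
      have h2 : 2 * ((t - l ^ 2 + 1) / (2 * (p - m * l))) * (p - m * l) = t - l ^ 2 + 1 := by
        rw [mul_right_comm, mul_div_cancel₀]
        exact mul_ne_zero two_ne_zero hne
      linarith
    · rw [hA]; field_simp
  have hs : 0 ≤ s - m ^ 2 := by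
    have h1 : 0 ≤ ∑ i ∈ tree r, (x i - m) ^ 2 := Finset.sum_nonneg fun i _ => sq_nonneg _
    have h2 : ∑ i ∈ tree r, (x i - m) ^ 2 = N * (s - m ^ 2) := by
      have h3 : ∑ i ∈ tree r, (x i - m) ^ 2 =
          ∑ i ∈ tree r, x i ^ 2 - 2 * m * ∑ i ∈ tree r, x i + N * m ^ 2 := by
        have h4 : N * m ^ 2 = ∑ i ∈ tree r, m ^ 2 := by simp [hN]
        rw [h4]
        simp only [Finset.mul_sum, ← Finset.sum_add_distrib, ← Finset.sum_sub_distrib]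
        exact Finset.sum_congr rfl fun i _ => by ring
      have h5 : ∑ i ∈ tree r, x i = N * m := by
        simp only [m, avg, ← hN]; field_simp
      have h6 : ∑ i ∈ tree r, x i ^ 2 = N * s := by
        simp only [s, avg, ← hN]; field_simp
      rw [h3, h5, h6]; ring
    rw [h2] at h1
    exact nonneg_of_mul_nonneg_right h1 hc
  have key : t - 2 * a * p - 2 * b * l + a ^ 2 * s + 2 * a * b * m + b ^ 2 -
      (t - 2 * A * p - 2 * (l - A * m) * l + A ^ 2 * s + 2 * A * (l - A * m) * m +
        (l - A * m) ^ 2) = (b - l + a * m) ^ 2 + (a - A) ^ 2 * (s - m ^ 2) := by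
    linear_combination (2 * a - 2 * A) * hk
  linarith [mul_nonneg (sq_nonneg (a - A)) hs, sq_nonneg (b - l + a * m)]

/-- The estimator of `θ = (α₀, β₀, α₁, β₁)` computed from the observations `x i`,
`i ∈ tree (r + 1)`. -/
noncomputable def thetaHat (x : ℕ → ℝ) (r : ℕ) : ℝ × ℝ × ℝ × ℝ :=
  (alphaHat x 0 r, betaHat x 0 r, alphaHat x 1 r, betaHat x 1 r)

/-- The noise covariance matrix `σ² (1 ρ; ρ 1)`. -/
def noiseCov (σ ρ : ℝ) : Matrix (Fin 2) (Fin 2) ℝ := σ ^ 2 • !![1, ρ; ρ, 1]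

/-- The noise `(ε_{2n}, ε_{2n+1})` of the two daughters of `n`. -/
def noisePair {Ω : Type*} (ε : ℕ → Ω → ℝ) (n : ℕ+) (ω : Ω) : EuclideanSpace ℝ (Fin 2) :=
  !₂[ε (2 * n) ω, ε (2 * n + 1) ω]

/-- `X` (indexed by the positive integers; the value at index `0` is irrelevant) follows the
bifurcating autoregressive model with parameters `α₀ β₀ α₁ β₁ σ ρ`, ancestor law `ν` and noise `ε`
(only the indices `≥ 2` matter) on the probability space `(Ω, P)`. -/
structure IsModel {Ω : Type*} [MeasurableSpace Ω] (P : Measure Ω) (α₀ β₀ α₁ β₁ σ ρ : ℝ)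
    (ν : Measure ℝ) (ε X : ℕ → Ω → ℝ) : Prop where
  measurable_X : ∀ n, 1 ≤ n → Measurable (X n)
  measurable_noise : ∀ n, 2 ≤ n → Measurable (ε n)
  law_ancestor : HasLaw (X 1) ν P
  new_pole : ∀ n, 1 ≤ n → ∀ᵐ ω ∂P, X (2 * n) ω = α₀ * X n ω + β₀ + ε (2 * n) ω
  old_pole : ∀ n, 1 ≤ n → ∀ᵐ ω ∂P, X (2 * n + 1) ω = α₁ * X n ω + β₁ + ε (2 * n + 1) ω
  law_noise : ∀ n : ℕ+, HasLaw (noisePair ε n) (multivariateGaussian 0 (noiseCov σ ρ)) P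
  indep_noise : iIndepFun (noisePair ε) P
  indep_ancestor : IndepFun (X 1) (fun ω (n : ℕ+) => noisePair ε n ω) P

end BAR

/-! ### Averages over the binary tree. -/

namespace BAR

/-! The estimator is a continuous function of a few empirical averages, so the proof splits into a
probabilistic part and a pathwise part.

Probability: `tendsto_avg_mul_noise` shows that averages of `A i * h (ε (2 * i + e))`, with `A`
predictable and bounded in `L²` and `h` centered, tend to 0 almost surely. The summands are pairwise
orthogonal and the tree grows geometrically, so the second moments of the averages are summable
(`tendsto_avg_of_orthogonal`). This is applied to the noise, to its centered square and to the noise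
times the mother's value; the last case needs the uniform bound `exists_integral_sq_le`.

Pathwise: the tree is its root together with the daughters of the previous tree, so the averages of
`x` and `x ^ 2` obey perturbed affine recursions, with limiting slopes the means of `α e` and of `α
e ^ 2`. These slopes are smaller than 1 in absolute value, so both averages converge
(`exists_tendsto_avg`). The limiting empirical variance is positive, and passing to the limit in the
formulas gives the parameters (`tendsto_alphaHat_betaHat`). -/

theorem tree_eq_Ico (r : ℕ) : tree r = Finset.Ico 1 (2 ^ (r + 1)) := by
  induction r with
  | zero => simp [tree, gen]
  | succ r ih =>
    have h : tree (r + 1) = gen (r + 1) ∪ tree r := by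
      simp only [tree]
      rw [Finset.range_add_one, Finset.biUnion_insert]
    rw [h, ih, gen, Finset.union_comm]
    exact Finset.Ico_union_Ico_eq_Ico Nat.one_le_two_pow
      (Nat.pow_le_pow_right (by norm_num) (by omega))

theorem one_le_of_mem_tree {r i : ℕ} (h : i ∈ tree r) : 1 ≤ i := by
  rw [tree_eq_Ico] at h
  exact (Finset.mem_Ico.1 h).1

theorem card_tree_add_one (r : ℕ) : ((tree r).card : ℝ) + 1 = 2 ^ (r + 1) := by
  rw [tree_eq_Ico, Nat.card_Ico, Nat.cast_sub Nat.one_le_two_pow]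
  simp

theorem two_pow_le_card_tree (r : ℕ) : (2 : ℝ) ^ r ≤ (tree r).card := by
  have h := card_tree_add_one r
  have h1 : (1 : ℝ) ≤ 2 ^ r := one_le_pow₀ (by norm_num)
  rw [pow_succ] at h
  linarith

theorem card_tree_pos (r : ℕ) : (0 : ℝ) < (tree r).card :=
  lt_of_lt_of_le (by positivity) (two_pow_le_card_tree r)

theorem card_tree_succ (r : ℕ) : ((tree (r + 1)).card : ℝ) = 2 * (tree r).card + 1 := by
  have h := card_tree_add_one r
  have h' := card_tree_add_one (r + 1)
  rw [pow_succ] at h'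
  linarith

theorem sum_Ico_one_two_mul (f : ℕ → ℝ) {N : ℕ} (hN : 1 ≤ N) :
    ∑ i ∈ Finset.Ico 1 (2 * N), f i = f 1 + ∑ e : Fin 2, ∑ i ∈ Finset.Ico 1 N, f (2 * i + e) := by
  induction N, hN using Nat.le_induction with
  | base => simp
  | succ N hN ih =>
    rw [show 2 * (N + 1) = 2 * N + 1 + 1 by ring, Finset.sum_Ico_succ_top (by omega),
      Finset.sum_Ico_succ_top (by omega), ih]
    simp only [Fin.sum_univ_two, Finset.sum_Ico_succ_top hN]
    simp
    ring

theorem tendsto_card_tree : Tendsto (fun r => ((tree r).card : ℝ)) atTop atTop :=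
  tendsto_atTop_mono two_pow_le_card_tree (tendsto_pow_atTop_atTop_of_one_lt (by norm_num))

/-- Every non-root index of the larger tree is `2 * i + e` for exactly one mother `i` of the smaller
tree and one `e`. -/
theorem avg_succ (r : ℕ) (f : ℕ → ℝ) :
    avg (r + 1) f = ((tree (r + 1)).card : ℝ)⁻¹ * f 1 +
      (tree r).card / (tree (r + 1)).card * ∑ e : Fin 2, avg r (fun i => f (2 * i + e)) := by
  have h := card_tree_pos r
  have h' := card_tree_pos (r + 1)
  unfold avg
  rw [← Finset.mul_sum]
  conv_lhs => rw [tree_eq_Ico (r + 1), pow_succ' 2 (r + 1),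
    sum_Ico_one_two_mul f Nat.one_le_two_pow, ← pow_succ', ← tree_eq_Ico, ← tree_eq_Ico]
  field_simp

theorem avg_congr {r : ℕ} {f g : ℕ → ℝ} (h : ∀ i, 1 ≤ i → f i = g i) : avg r f = avg r g := by
  unfold avg
  rw [Finset.sum_congr rfl fun i hi => h i (one_le_of_mem_tree hi)]

theorem avg_add (r : ℕ) (f g : ℕ → ℝ) : avg r (fun i => f i + g i) = avg r f + avg r g := by
  simp [avg, Finset.sum_add_distrib, mul_add]

theorem avg_const_mul (r : ℕ) (c : ℝ) (f : ℕ → ℝ) : avg r (fun i => c * f i) = c * avg r f := by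
  simp only [avg, ← Finset.mul_sum]
  ring

theorem avg_const (r : ℕ) (c : ℝ) : avg r (fun _ => c) = c := by
  have h := card_tree_pos r
  simp only [avg, Finset.sum_const, nsmul_eq_mul]
  field_simp

/-! ### Perturbed contractions. -/

/-- Once `δ` is below `(1 - k) * (η / 2)`, the level `η / 2` is preserved by the recursion, and the
excess over it decays like `k ^ n`. -/
theorem tendsto_zero_of_succ_le {v δ : ℕ → ℝ} {k : ℝ} (hk : 0 ≤ k) (hk1 : k < 1)
    (hv : ∀ r, 0 ≤ v r) (hδ : Tendsto δ atTop (𝓝 0))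
    (h : ∀ᶠ r in atTop, v (r + 1) ≤ k * v r + δ r) : Tendsto v atTop (𝓝 0) := by
  rw [Metric.tendsto_atTop]
  intro η hη
  have hη' : 0 < (1 - k) * (η / 2) := mul_pos (by linarith) (by linarith)
  obtain ⟨N, hN⟩ := eventually_atTop.1 (h.and (hδ.eventually (ge_mem_nhds hη')))
  have key : ∀ n, v (N + n) ≤ k ^ n * v N + η / 2 := by
    intro n
    induction n with
    | zero => simp; linarith
    | succ n ih =>
      obtain ⟨h1, h2⟩ := hN (N + n) (by omega)
      have h3 := mul_le_mul_of_nonneg_left ih hk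
      rw [← add_assoc, pow_succ]
      linarith
  have hlim : Tendsto (fun n => k ^ n * v N) atTop (𝓝 0) := by
    simpa using (tendsto_pow_atTop_nhds_zero_of_lt_one hk hk1).mul_const (v N)
  obtain ⟨n₀, hn₀⟩ := eventually_atTop.1 (hlim.eventually (gt_mem_nhds (half_pos hη)))
  refine ⟨N + n₀, fun n hn => ?_⟩
  obtain ⟨m, rfl⟩ := Nat.exists_eq_add_of_le (show N ≤ n by omega)
  rw [Real.dist_0_eq_abs, abs_of_nonneg (hv _)]
  linarith [key m, hn₀ m (by omega)]

/-- `L` is the fixed point of the limiting affine map. The distance to `L` eventually contracts by a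
factor `k` with `|a'| < k < 1`, up to the error `|a r * L + b r - L|`, which vanishes in the limit.
-/
theorem tendsto_of_affine_recursion {u a b : ℕ → ℝ} {a' b' : ℝ} (ha' : |a'| < 1)
    (ha : Tendsto a atTop (𝓝 a')) (hb : Tendsto b atTop (𝓝 b'))
    (h : ∀ r, u (r + 1) = a r * u r + b r) : Tendsto u atTop (𝓝 (b' / (1 - a'))) := by
  set L := b' / (1 - a') with hL
  have hne : 1 - a' ≠ 0 := by linarith [(abs_lt.1 ha').2]
  have hfix : a' * L + b' - L = 0 := by rw [hL]; field_simp; ring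
  obtain ⟨k, hk, hk1⟩ := exists_between ha'
  rw [tendsto_iff_norm_sub_tendsto_zero]
  refine tendsto_zero_of_succ_le (δ := fun r => |a r * L + b r - L|)
    ((abs_nonneg _).trans hk.le) hk1 (fun _ => norm_nonneg _) ?_ ?_
  · have := (((ha.mul_const L).add hb).sub_const L).abs
    rwa [hfix, abs_zero] at this
  · filter_upwards [ha.abs.eventually (gt_mem_nhds hk)] with r hr
    rw [h, Real.norm_eq_abs, Real.norm_eq_abs,
      show a r * u r + b r - L = a r * (u r - L) + (a r * L + b r - L) by ring]
    refine (abs_add_le _ _).trans (add_le_add_left ?_ _)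
    rw [abs_mul]
    exact mul_le_mul_of_nonneg_right hr.le (abs_nonneg _)

theorem tendsto_card_tree_div_succ :
    Tendsto (fun r => ((tree r).card : ℝ) / (tree (r + 1)).card) atTop (𝓝 (1 / 2)) := by
  have h : ∀ r, ((tree r).card : ℝ) / (tree (r + 1)).card =
      1 / 2 - 1 / 2 * ((tree (r + 1)).card : ℝ)⁻¹ := fun r => by
    have h' := card_tree_pos (r + 1)
    field_simp
    linarith [card_tree_succ r]
  rw [funext h]
  simpa using (((tendsto_card_tree.comp (tendsto_add_atTop_nat 1)).inv_tendsto_atTop).const_mul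
    (2⁻¹ : ℝ)).const_sub 2⁻¹

/-- Averages over the tree of a sequence whose average over the daughters is asymptotically an
affine contraction of its average over the mothers. -/
theorem tendsto_avg_of_daughters {f : ℕ → ℝ} {a : Fin 2 → ℝ} {b : Fin 2 → ℕ → ℝ} {b' : Fin 2 → ℝ}
    (ha : |(∑ e, a e) / 2| < 1) (hb : ∀ e, Tendsto (b e) atTop (𝓝 (b' e)))
    (h : ∀ e r, avg r (fun i => f (2 * i + (e : Fin 2))) = a e * avg r f + b e r) :
    Tendsto (fun r => avg r f) atTop (𝓝 ((∑ e, b' e) / 2 / (1 - (∑ e, a e) / 2))) := by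
  have hc : Tendsto (fun r => ((tree (r + 1)).card : ℝ)⁻¹ * f 1) atTop (𝓝 0) := by
    simpa using ((tendsto_card_tree.comp (tendsto_add_atTop_nat 1)).inv_tendsto_atTop).mul_const
      (f 1)
  have hd := tendsto_card_tree_div_succ
  refine tendsto_of_affine_recursion
    (a := fun r => (tree r).card / (tree (r + 1)).card * ∑ e, a e)
    (b := fun r => ((tree (r + 1)).card : ℝ)⁻¹ * f 1 +
      (tree r).card / (tree (r + 1)).card * ∑ e, b e r) ha ?_ ?_ fun r => ?_
  · convert hd.mul_const (∑ e, a e) using 2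
    ring
  · convert hc.add (hd.mul (tendsto_finsetSum _ fun e _ => hb e)) using 2
    ring
  · rw [avg_succ]
    simp_rw [h, Finset.sum_add_distrib, ← Finset.sum_mul]
    ring

/-! ### Pathwise convergence of the estimators. -/

section Deterministic

variable {x u : ℕ → ℝ} {α β : Fin 2 → ℝ} {s : ℝ}

theorem avg_daughters (hx : ∀ e : Fin 2, ∀ i, 1 ≤ i → x (2 * i + e) = α e * x i + β e + u (2 * i + e))
    (e : Fin 2) (r : ℕ) : avg r (fun i => x (2 * i + e)) =
      α e * avg r x + (β e + avg r (fun i => u (2 * i + e))) := by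
  rw [avg_congr (hx e), avg_add, avg_add, avg_const_mul, avg_const, add_assoc]

theorem avg_mul_daughters
    (hx : ∀ e : Fin 2, ∀ i, 1 ≤ i → x (2 * i + e) = α e * x i + β e + u (2 * i + e))
    (e : Fin 2) (r : ℕ) : avg r (fun i => x i * x (2 * i + e)) =
      α e * avg r (fun i => x i ^ 2) + β e * avg r x + avg r (fun i => x i * u (2 * i + e)) := by
  rw [avg_congr (g := fun i => α e * x i ^ 2 + β e * x i + x i * u (2 * i + e))
    fun i hi => by rw [hx e i hi]; ring, avg_add, avg_add, avg_const_mul, avg_const_mul]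

theorem avg_sq_daughters
    (hx : ∀ e : Fin 2, ∀ i, 1 ≤ i → x (2 * i + e) = α e * x i + β e + u (2 * i + e))
    (e : Fin 2) (r : ℕ) : avg r (fun i => x (2 * i + e) ^ 2) =
      α e ^ 2 * avg r (fun i => x i ^ 2) + (2 * α e * β e * avg r x + β e ^ 2 +
        2 * α e * avg r (fun i => x i * u (2 * i + e)) + 2 * β e * avg r (fun i => u (2 * i + e)) +
        avg r (fun i => u (2 * i + e) ^ 2)) := by
  rw [avg_congr (g := fun i => α e ^ 2 * x i ^ 2 + (2 * α e * β e * x i + β e ^ 2 +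
      2 * α e * (x i * u (2 * i + e)) + 2 * β e * u (2 * i + e) + u (2 * i + e) ^ 2))
    fun i hi => by rw [hx e i hi]; ring]
  simp only [avg_add, avg_const_mul, avg_const]

/-- The averages of the observations and of their squares converge, and the limiting empirical
variance is positive. -/
theorem exists_tendsto_avg (hα : ∀ e, |α e| < 1) (hs : 0 < s)
    (hx : ∀ e : Fin 2, ∀ i, 1 ≤ i → x (2 * i + e) = α e * x i + β e + u (2 * i + e))
    (hu : ∀ e : Fin 2, Tendsto (fun r => avg r (fun i => u (2 * i + e))) atTop (𝓝 0))
    (hu2 : ∀ e : Fin 2, Tendsto (fun r => avg r (fun i => u (2 * i + e) ^ 2)) atTop (𝓝 s))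
    (hxu : ∀ e : Fin 2, Tendsto (fun r => avg r (fun i => x i * u (2 * i + e))) atTop (𝓝 0)) :
    ∃ m q : ℝ, Tendsto (fun r => avg r x) atTop (𝓝 m) ∧
      Tendsto (fun r => avg r (fun i => x i ^ 2)) atTop (𝓝 q) ∧ 0 < q - m ^ 2 := by
  have hα0 := abs_lt.1 (hα 0)
  have hα1 := abs_lt.1 (hα 1)
  have h0 : α 0 ^ 2 < 1 := (sq_lt_one_iff_abs_lt_one _).2 (hα 0)
  have h1 : α 1 ^ 2 < 1 := (sq_lt_one_iff_abs_lt_one _).2 (hα 1)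
  have hm := tendsto_avg_of_daughters (f := x) (a := α) (b' := β)
    (by rw [Fin.sum_univ_two, abs_lt]; constructor <;> linarith [hα0.1, hα1.1, hα0.2, hα1.2])
    (fun e => by simpa using (hu e).const_add (β e)) (avg_daughters hx)
  set m := (∑ e, β e) / 2 / (1 - (∑ e, α e) / 2) with hm'
  have hq := tendsto_avg_of_daughters (f := fun i => x i ^ 2) (a := fun e => α e ^ 2)
    (b' := fun e => 2 * α e * β e * m + β e ^ 2 + 2 * α e * 0 + 2 * β e * 0 + s)
    (by
      rw [Fin.sum_univ_two, abs_lt]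
      constructor <;> linarith [sq_nonneg (α 0), sq_nonneg (α 1)])
    (fun e => ((((hm.const_mul (2 * α e * β e)).add_const (β e ^ 2)).add
      ((hxu e).const_mul (2 * α e))).add ((hu e).const_mul (2 * β e))).add (hu2 e))
    (avg_sq_daughters hx)
  refine ⟨m, _, hm, hq, ?_⟩
  simp only [Fin.sum_univ_two] at hm' ⊢
  have hd : 0 < 1 - (α 0 ^ 2 + α 1 ^ 2) / 2 := by linarith
  have hd' : 1 - (α 0 + α 1) / 2 ≠ 0 := by linarith [hα0.2, hα1.2]
  have hme : m = (α 0 * m + β 0 + (α 1 * m + β 1)) / 2 := by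
    rw [eq_div_iff hd'] at hm'
    linarith
  rw [sub_pos, lt_div_iff₀ hd]
  -- As `m` is the mean of the two numbers `α e * m + β e`, the limiting variance times `1 - (α 0 ^
  -- 2 + α 1 ^ 2) / 2` equals `s` plus a quarter of their squared difference.
  nlinarith [sq_nonneg (α 0 * m + β 0 - (α 1 * m + β 1)), congrArg (· ^ 2) hme]

theorem tendsto_alphaHat_betaHat (hα : ∀ e, |α e| < 1) (hs : 0 < s)
    (hx : ∀ e : Fin 2, ∀ i, 1 ≤ i → x (2 * i + e) = α e * x i + β e + u (2 * i + e))
    (hu : ∀ e : Fin 2, Tendsto (fun r => avg r (fun i => u (2 * i + e))) atTop (𝓝 0))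
    (hu2 : ∀ e : Fin 2, Tendsto (fun r => avg r (fun i => u (2 * i + e) ^ 2)) atTop (𝓝 s))
    (hxu : ∀ e : Fin 2, Tendsto (fun r => avg r (fun i => x i * u (2 * i + e))) atTop (𝓝 0))
    (e : Fin 2) : Tendsto (alphaHat x e) atTop (𝓝 (α e)) ∧
      Tendsto (betaHat x e) atTop (𝓝 (β e)) := by
  obtain ⟨m, q, hm, hq, hpos⟩ := exists_tendsto_avg hα hs hx hu hu2 hxu
  have hl : Tendsto (fun r => avg r (fun i => x (2 * i + e))) atTop (𝓝 (α e * m + β e)) := by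
    simp_rw [avg_daughters hx]
    simpa using (hm.const_mul (α e)).add ((hu e).const_add (β e))
  have hp : Tendsto (fun r => avg r (fun i => x i * x (2 * i + e))) atTop
      (𝓝 (α e * q + β e * m)) := by
    simp_rw [avg_mul_daughters hx]
    simpa using ((hq.const_mul (α e)).add (hm.const_mul (β e))).add (hxu e)
  have ha : Tendsto (alphaHat x e) atTop (𝓝 (α e)) := by
    -- The denominator has a positive limit, so the value chosen for a vanishing denominator does
    -- not matter.
    have h := (hp.sub (hm.mul hl)).div (hq.sub (hm.pow 2)) hpos.ne'
    rwa [show (α e * q + β e * m - m * (α e * m + β e)) / (q - m ^ 2) = α e by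
      rw [div_eq_iff hpos.ne']; ring] at h
  refine ⟨ha, ?_⟩
  have h := hl.sub (ha.mul hm)
  rwa [add_sub_cancel_left] at h

end Deterministic

/-! ### Law of large numbers for orthogonal variables. -/

section Orthogonal

variable {Ω : Type*} [MeasurableSpace Ω] {P : Measure Ω} {Y : ℕ → Ω → ℝ} {C : ℝ}

theorem integral_sum_sq_le (s : Finset ℕ) (hY : ∀ i ∈ s, MemLp (Y i) 2 P)
    (horth : ∀ i ∈ s, ∀ j ∈ s, i < j → ∫ ω, Y i ω * Y j ω ∂P = 0)
    (hC : ∀ i ∈ s, ∫ ω, Y i ω ^ 2 ∂P ≤ C) : ∫ ω, (∑ i ∈ s, Y i ω) ^ 2 ∂P ≤ s.card * C := by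
  have hint : ∀ i ∈ s, ∀ j ∈ s, Integrable (fun ω => Y i ω * Y j ω) P :=
    fun i hi j hj => (hY i hi).integrable_mul (hY j hj)
  have hne : ∀ i ∈ s, ∀ j ∈ s, j ≠ i → ∫ ω, Y i ω * Y j ω ∂P = 0 := by
    intro i hi j hj hij
    rcases lt_or_gt_of_ne hij with h | h
    · simpa [mul_comm] using horth j hj i hi h
    · exact horth i hi j hj h
  calc ∫ ω, (∑ i ∈ s, Y i ω) ^ 2 ∂P
      = ∑ i ∈ s, ∑ j ∈ s, ∫ ω, Y i ω * Y j ω ∂P := by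
        simp_rw [sq, Finset.sum_mul_sum]
        rw [integral_finsetSum _ fun i hi => integrable_finsetSum _ (hint i hi)]
        exact Finset.sum_congr rfl fun i hi => integral_finsetSum _ (hint i hi)
    _ = ∑ i ∈ s, ∫ ω, Y i ω ^ 2 ∂P := by
        refine Finset.sum_congr rfl fun i hi => ?_
        rw [Finset.sum_eq_single_of_mem i hi (hne i hi)]
        simp_rw [sq]
    _ ≤ s.card * C := by
        rw [← nsmul_eq_mul]
        exact Finset.sum_le_card_nsmul _ _ _ hC

/-- Strong law of large numbers along the binary tree for pairwise orthogonal variables which are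
bounded in `L²`. -/
theorem tendsto_avg_of_orthogonal (hY : ∀ i, 1 ≤ i → MemLp (Y i) 2 P)
    (horth : ∀ i j, 1 ≤ i → i < j → ∫ ω, Y i ω * Y j ω ∂P = 0)
    (hC : ∀ i, 1 ≤ i → ∫ ω, Y i ω ^ 2 ∂P ≤ C) :
    ∀ᵐ ω ∂P, Tendsto (fun r => avg r fun i => Y i ω) atTop (𝓝 0) := by
  have hC0 : 0 ≤ C := (integral_nonneg fun ω => sq_nonneg (Y 1 ω)).trans (hC 1 le_rfl)
  have hLp : ∀ r, MemLp (fun ω => avg r fun i => Y i ω) 2 P := fun r =>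
    (memLp_finsetSum _ fun i hi => hY i (one_le_of_mem_tree hi)).const_mul _
  have hle : ∀ r, ∫ ω, (avg r fun i => Y i ω) ^ 2 ∂P ≤ C * (1 / 2) ^ r := by
    intro r
    have h := integral_sum_sq_le (tree r) (fun i hi => hY i (one_le_of_mem_tree hi))
      (fun i hi j _ hij => horth i j (one_le_of_mem_tree hi) hij)
      (fun i hi => hC i (one_le_of_mem_tree hi))
    have hN := card_tree_pos r
    simp_rw [avg, mul_pow, integral_const_mul]
    refine (mul_le_mul_of_nonneg_left h (by positivity)).trans ?_
    rw [show (((tree r).card : ℝ)⁻¹) ^ 2 * ((tree r).card * C) = C * ((tree r).card : ℝ)⁻¹ by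
      field_simp, one_div_pow, one_div]
    gcongr
    exact two_pow_le_card_tree r
  -- The `L¹` norms of the squared averages are dominated by a geometric series, so the squares are
  -- almost surely summable and tend to 0.
  have hsum := summable_norm_of_tsum_eLpNorm_ne_top (μ := P) (p := 1) le_rfl
    (f := fun r ω => (avg r fun i => Y i ω) ^ 2) (fun r => (hLp r).integrable_sq.1) (by
      have hs : Summable fun r : ℕ => C * (1 / 2 : ℝ) ^ r :=
        (summable_geometric_of_lt_one (by norm_num) (by norm_num)).mul_left C
      refine ne_top_of_le_ne_top hs.tsum_ofReal_ne_top (ENNReal.tsum_le_tsum fun r => ?_)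
      rw [eLpNorm_one_eq_lintegral_enorm, ← ofReal_integral_norm_eq_lintegral_enorm
        (hLp r).integrable_sq]
      simp_rw [Real.norm_eq_abs, abs_sq]
      exact ENNReal.ofReal_le_ofReal (hle r))
  filter_upwards [hsum] with ω hω
  have h := hω.tendsto_atTop_zero
  simp_rw [Real.norm_eq_abs, abs_sq] at h
  have h' := h.sqrt
  simp_rw [Real.sqrt_sq_eq_abs, Real.sqrt_zero] at h'
  exact (tendsto_zero_iff_abs_tendsto_zero _).2 h'

end Orthogonal

/-- The joint law is a product of three laws, which can be reassociated. It serves to join the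
ancestor to the earlier noises. -/
theorem indepFun_prodMk_left {Ω A B D : Type*} [MeasurableSpace Ω] [MeasurableSpace A]
    [MeasurableSpace B] [MeasurableSpace D] {P : Measure Ω} [IsProbabilityMeasure P]
    {a : Ω → A} {b : Ω → B} {d : Ω → D} (ha : Measurable a) (hb : Measurable b) (hd : Measurable d)
    (h : IndepFun a (fun ω => (b ω, d ω)) P) (hbd : IndepFun b d P) :
    IndepFun (fun ω => (a ω, b ω)) d P := by
  have := Measure.isProbabilityMeasure_map (μ := P) ha.aemeasurable
  have := Measure.isProbabilityMeasure_map (μ := P) hb.aemeasurable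
  have := Measure.isProbabilityMeasure_map (μ := P) hd.aemeasurable
  have hab : IndepFun a b P := h.comp measurable_id measurable_fst
  have h1 := h.map_prod_eq_prod_map_map ha.aemeasurable (hb.prodMk hd).aemeasurable
  rw [hbd.map_prod_eq_prod_map_map hb.aemeasurable hd.aemeasurable] at h1
  rw [indepFun_iff_map_prod_eq_prod_map_map (ha.prodMk hb).aemeasurable hd.aemeasurable,
    hab.map_prod_eq_prod_map_map ha.aemeasurable hb.aemeasurable,
    ← (measurePreserving_prodAssoc (P.map a) (P.map b) (P.map d)).symm.map_eq, ← h1,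
    Measure.map_map (MeasurableEquiv.measurable _) (by fun_prop)]
  rfl

/-! ### Gaussian noise and its moments. -/

section Noise

variable {σ ρ : ℝ}

theorem posSemidef_noiseCov (hρ : ρ ∈ Set.Ioo (-1 : ℝ) 1) : (noiseCov σ ρ).PosSemidef := by
  refine Matrix.PosSemidef.smul ?_ (sq_nonneg σ)
  refine Matrix.PosSemidef.of_dotProduct_mulVec_nonneg ?_ fun v => ?_
  · ext i j
    fin_cases i <;> fin_cases j <;> simp
  · simp [Matrix.mulVec, dotProduct, Fin.sum_univ_two]
    -- The quadratic form is `(v 0 + ρ * v 1) ^ 2 + (1 - ρ ^ 2) * v 1 ^ 2`.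
    nlinarith [sq_nonneg (v 0 + ρ * v 1), sq_nonneg (v 1), mul_pos (sub_pos.2 hρ.2)
      (neg_lt_iff_pos_add.1 hρ.1), mul_nonneg (sq_nonneg (v 1)) (mul_pos (sub_pos.2 hρ.2)
      (neg_lt_iff_pos_add.1 hρ.1)).le]

theorem noiseCov_diag (e : Fin 2) : noiseCov σ ρ e e = σ ^ 2 := by
  fin_cases e <;> simp [noiseCov]

theorem measurePreserving_eval_noise (hρ : ρ ∈ Set.Ioo (-1 : ℝ) 1) (e : Fin 2) :
    MeasurePreserving (fun x : EuclideanSpace ℝ (Fin 2) => x e)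
      (multivariateGaussian 0 (noiseCov σ ρ)) (gaussianReal 0 (σ ^ 2).toNNReal) := by
  have h := measurePreserving_eval_multivariateGaussian (μ := 0)
    (posSemidef_noiseCov (σ := σ) hρ) (i := e)
  rwa [noiseCov_diag] at h

theorem integral_sq_gaussianReal (v : NNReal) : ∫ x, x ^ 2 ∂gaussianReal 0 v = v := by
  have h := variance_fun_id_gaussianReal (μ := 0) (v := v)
  rwa [variance_of_integral_eq_zero (by fun_prop) (by simp)] at h

theorem memLp_sq_gaussianReal (v : NNReal) : MemLp (fun x : ℝ => x ^ 2) 2 (gaussianReal 0 v) := by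
  rw [memLp_two_iff_integrable_sq (by fun_prop)]
  have h := (memLp_id_gaussianReal (μ := 0) (v := v) 4).integrable_norm_pow (p := 4) (by norm_num)
  refine h.congr (ae_of_all _ fun x => ?_)
  simp only [id, Real.norm_eq_abs]
  rw [← pow_mul, Even.pow_abs (by decide)]

theorem noisePair_apply {Ω : Type*} (ε : ℕ → Ω → ℝ) (n : ℕ+) (ω : Ω) (e : Fin 2) :
    noisePair ε n ω e = ε (2 * n + e) ω := by
  fin_cases e <;> simp [noisePair]

end Noise

namespace IsModel

variable {Ω : Type*} [MeasurableSpace Ω] {P : Measure Ω} {α₀ β₀ α₁ β₁ σ ρ : ℝ} {ν : Measure ℝ}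
  {ε X : ℕ → Ω → ℝ}

theorem measurable_noisePair (hX : IsModel P α₀ β₀ α₁ β₁ σ ρ ν ε X) (n : ℕ+) :
    Measurable (noisePair ε n) := by
  refine (WithLp.measurable_toLp 2 _).comp (measurable_pi_iff.2 fun e => ?_)
  have h := n.pos
  fin_cases e
  · exact hX.measurable_noise _ (by simp; omega)
  · exact hX.measurable_noise _ (by simp; omega)

theorem daughter (hX : IsModel P α₀ β₀ α₁ β₁ σ ρ ν ε X) (e : Fin 2) (n : ℕ) (hn : 1 ≤ n) :
    X (2 * n + e) =ᵐ[P] fun ω => ![α₀, α₁] e * X n ω + ![β₀, β₁] e + ε (2 * n + e) ω := by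
  fin_cases e
  · exact hX.new_pole n hn
  · exact hX.old_pole n hn

end IsModel

/-- The ancestor together with the noises of the daughters of the individuals before `j`. -/
def pastMap {Ω : Type*} (ε X : ℕ → Ω → ℝ) (j : ℕ+) (ω : Ω) :
    ℝ × (Finset.Iio j → EuclideanSpace ℝ (Fin 2)) :=
  (X 1 ω, fun n => noisePair ε n ω)

/-- The σ-algebra generated by `pastMap`. -/
abbrev past {Ω : Type*} (ε X : ℕ → Ω → ℝ) (j : ℕ+) : MeasurableSpace Ω :=
  MeasurableSpace.comap (pastMap ε X j) inferInstance

theorem stronglyMeasurable_noise_past {Ω : Type*} {ε X : ℕ → Ω → ℝ} {i j : ℕ+} (hij : i < j)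
    (e : Fin 2) : StronglyMeasurable[past ε X j] (ε (2 * i + e)) := by
  have h : Measurable[past ε X j] (pastMap ε X j) := comap_measurable _
  have h' : Measurable[past ε X j] fun ω => noisePair ε i ω e :=
    (by fun_prop : Measurable fun z : ℝ × (Finset.Iio j → EuclideanSpace ℝ (Fin 2)) =>
      z.2 ⟨i, Finset.mem_Iio.2 hij⟩ e).comp h
  simp_rw [noisePair_apply] at h'
  exact h'.stronglyMeasurable

/-! ### Predictability, moment bounds and limits of the noise averages. -/

namespace IsModel

variable {Ω : Type*} [MeasurableSpace Ω] {P : Measure Ω} {α₀ β₀ α₁ β₁ σ ρ : ℝ} {ν : Measure ℝ}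
  {ε X : ℕ → Ω → ℝ}

theorem indepFun_pastMap [IsProbabilityMeasure P] (hX : IsModel P α₀ β₀ α₁ β₁ σ ρ ν ε X) (j : ℕ+) :
    IndepFun (pastMap ε X j) (noisePair ε j) P := by
  refine indepFun_prodMk_left (hX.measurable_X 1 le_rfl)
    (measurable_pi_iff.2 fun n => hX.measurable_noisePair n) (hX.measurable_noisePair j) ?_ ?_
  · exact hX.indep_ancestor.comp measurable_id
      (ψ := fun f : ℕ+ → EuclideanSpace ℝ (Fin 2) => (fun n : Finset.Iio j => f n, f j))
      (by fun_prop)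
  · have h := hX.indep_noise.indepFun_finset (Finset.Iio j) {j} (by simp) hX.measurable_noisePair
    exact h.comp measurable_id
      (ψ := fun f : ({j} : Finset ℕ+) → EuclideanSpace ℝ (Fin 2) => f ⟨j, by simp⟩) (by fun_prop)

theorem indepFun_of_past [IsProbabilityMeasure P] (hX : IsModel P α₀ β₀ α₁ β₁ σ ρ ν ε X) {j : ℕ+}
    {Z : Ω → ℝ} (hZ : AEStronglyMeasurable[past ε X j] Z P) :
    IndepFun Z (noisePair ε j) P := by
  have h := hX.indepFun_pastMap j
  refine IndepFun.congr (f := hZ.mk Z) ?_ hZ.ae_eq_mk.symm (EventuallyEq.refl _ _)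
  rw [IndepFun_iff_Indep] at h ⊢
  exact indep_of_indep_of_le_left h hZ.measurable_mk.comap_le

/-- A daughter `2 * n + e ≤ j` has a mother `n < j`, so her noise already belongs to the past of
`j`. Measurability is only up to null sets because the model equations hold almost surely. -/
theorem aestronglyMeasurable_past (hX : IsModel P α₀ β₀ α₁ β₁ σ ρ ν ε X) (j : ℕ+) (i : ℕ)
    (hi : 1 ≤ i) (hij : i ≤ j) : AEStronglyMeasurable[past ε X j] (X i) P := by
  induction i using Nat.strong_induction_on with
  | _ i ih =>
    rcases hi.eq_or_lt with rfl | hi1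
    · have h : Measurable[past ε X j] (pastMap ε X j) := comap_measurable _
      exact (Measurable.stronglyMeasurable (measurable_fst.comp h)).aestronglyMeasurable
    · obtain ⟨n, e, hn, rfl⟩ : ∃ (n : ℕ) (e : Fin 2), 1 ≤ n ∧ i = 2 * n + e :=
        ⟨i / 2, ⟨i % 2, Nat.mod_lt _ (by norm_num)⟩, by omega, by simp; omega⟩
      lift n to ℕ+ using hn
      have hn := n.pos
      have h1 := ih n (by omega) hn (by omega)
      have h2 : StronglyMeasurable[past ε X j] (ε (2 * n + e)) :=
        stronglyMeasurable_noise_past (PNat.coe_lt_coe _ _ |>.1 (by omega)) e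
      refine AEStronglyMeasurable.congr ?_ (hX.daughter e n hn).symm
      exact ((h1.const_mul _).add aestronglyMeasurable_const).add h2.aestronglyMeasurable

theorem hasLaw_noise (hX : IsModel P α₀ β₀ α₁ β₁ σ ρ ν ε X) (hρ : ρ ∈ Set.Ioo (-1 : ℝ) 1)
    (n : ℕ+) (e : Fin 2) :
    HasLaw (ε (2 * n + e)) (gaussianReal 0 (σ ^ 2).toNNReal) P := by
  have h := (measurePreserving_eval_noise (σ := σ) hρ e).fun_comp_hasLaw (hX.law_noise n)
  simpa only [noisePair_apply] using h

theorem _root_.ProbabilityTheory.HasLaw.memLp_comp {Y : Ω → ℝ} {μ : Measure ℝ} (hY : HasLaw Y μ P)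
    {h : ℝ → ℝ} {p : ENNReal} (hh : MemLp h p μ) : MemLp (fun ω => h (Y ω)) p P := by
  rw [← hY.map_eq] at hh
  exact hh.comp_of_map hY.aemeasurable

/-- Strong law of large numbers for the products of a predictable sequence with a centered function
of the noise. -/
theorem tendsto_avg_mul_noise [IsProbabilityMeasure P] (hX : IsModel P α₀ β₀ α₁ β₁ σ ρ ν ε X)
    (hρ : ρ ∈ Set.Ioo (-1 : ℝ) 1) {A : ℕ → Ω → ℝ} {M : ℝ} (hA : ∀ i, 1 ≤ i → MemLp (A i) 2 P)
    (hM : ∀ i, 1 ≤ i → ∫ ω, A i ω ^ 2 ∂P ≤ M)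
    (hpast : ∀ (j : ℕ+) (i : ℕ), 1 ≤ i → i ≤ j → AEStronglyMeasurable[past ε X j] (A i) P)
    {h : ℝ → ℝ} (hh : Measurable h) (h2 : MemLp h 2 (gaussianReal 0 (σ ^ 2).toNNReal))
    (h0 : ∫ x, h x ∂gaussianReal 0 (σ ^ 2).toNNReal = 0) (e : Fin 2) :
    ∀ᵐ ω ∂P, Tendsto (fun r => avg r fun i => A i ω * h (ε (2 * i + e) ω)) atTop (𝓝 0) := by
  have hind : ∀ (j : ℕ+) (Z : Ω → ℝ), AEStronglyMeasurable[past ε X j] Z P → ∀ g : ℝ → ℝ,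
      Measurable g → IndepFun Z (fun ω => g (ε (2 * j + e) ω)) P := by
    intro j Z hZ g hg
    have h := (hX.indepFun_of_past hZ).comp measurable_id
      (ψ := fun v : EuclideanSpace ℝ (Fin 2) => g (v e)) (by fun_prop)
    simpa only [Function.comp_def, noisePair_apply, id] using h
  have hε : ∀ j : ℕ+, MemLp (fun ω => h (ε (2 * j + e) ω)) 2 P := fun j =>
    (hX.hasLaw_noise hρ j e).memLp_comp h2
  refine tendsto_avg_of_orthogonal
    (C := M * ∫ x, h x ^ 2 ∂gaussianReal 0 (σ ^ 2).toNNReal) ?_ ?_ ?_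
  · intro i hi
    lift i to ℕ+ using hi
    refine (memLp_two_iff_integrable_sq ((hA i i.pos).1.mul (hε i).1)).2 ?_
    simp_rw [Pi.mul_apply, mul_pow]
    -- Independence is what makes the product of two `L²` variables square integrable.
    exact (hind i _ ((hpast i i i.pos le_rfl).pow 2) (fun x => h x ^ 2) (hh.pow_const 2)).integrable_mul
      (hA i i.pos).integrable_sq (hε i).integrable_sq
  · intro i j hi hij
    lift j to ℕ+ using hi.trans hij.le
    lift i to ℕ+ using hi
    -- For `i < j`, all factors except the noise of the daughters of `j` lie in the past of `j`.
    -- Independence factors out the centered term, with no integrability needed for the triple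
    -- product.
    have hm : AEStronglyMeasurable[past ε X j]
        (fun ω => A i ω * h (ε (2 * i + e) ω) * A j ω) P :=
      ((hpast j i i.pos hij.le).mul (hh.comp (stronglyMeasurable_noise_past (X := X)
        (PNat.coe_lt_coe _ _ |>.1 hij) e).measurable).stronglyMeasurable.aestronglyMeasurable).mul
        (hpast j j j.pos le_rfl)
    have hprod := (hind j _ hm h hh).integral_fun_mul_eq_mul_integral
      (((hA i i.pos).1.mul (hε i).1).mul (hA j j.pos).1) (hε j).1
    simp_rw [← mul_assoc]
    have hint := (hX.hasLaw_noise hρ j e).integral_comp h2.1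
    rw [Function.comp_def] at hint
    rw [hprod, hint, h0, mul_zero]
  · intro i hi
    lift i to ℕ+ using hi
    simp_rw [mul_pow]
    rw [(hind i (fun ω => A i ω ^ 2) ((hpast i i i.pos le_rfl).pow 2) (fun x => h x ^ 2)
      (hh.pow_const 2)).integral_fun_mul_eq_mul_integral (hA i i.pos).integrable_sq.1
      (hε i).integrable_sq.1]
    refine mul_le_mul (hM i i.pos) (le_of_eq ?_) (integral_nonneg fun ω => sq_nonneg _)
      ((integral_nonneg fun ω => sq_nonneg _).trans (hM i i.pos))
    exact (hX.hasLaw_noise hρ i e).integral_comp (f := fun x => h x ^ 2) h2.integrable_sq.1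

theorem memLp_noise (hX : IsModel P α₀ β₀ α₁ β₁ σ ρ ν ε X) (hρ : ρ ∈ Set.Ioo (-1 : ℝ) 1)
    (n : ℕ+) (e : Fin 2) : MemLp (ε (2 * n + e)) 2 P :=
  (hX.hasLaw_noise hρ n e).memLp_comp (h := id) (memLp_id_gaussianReal 2)

theorem memLp_two [IsProbabilityMeasure P] (hX : IsModel P α₀ β₀ α₁ β₁ σ ρ ν ε X)
    (hρ : ρ ∈ Set.Ioo (-1 : ℝ) 1) (hν : Integrable (fun x : ℝ => |x| ^ 2) ν) (i : ℕ) (hi : 1 ≤ i) :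
    MemLp (X i) 2 P := by
  induction i using Nat.strong_induction_on with
  | _ i ih =>
    rcases hi.eq_or_lt with rfl | hi1
    · simp_rw [sq_abs] at hν
      exact hX.law_ancestor.memLp_comp (h := id)
        ((memLp_two_iff_integrable_sq (by fun_prop)).2 hν)
    · obtain ⟨n, e, hn, rfl⟩ : ∃ (n : ℕ) (e : Fin 2), 1 ≤ n ∧ i = 2 * n + e :=
        ⟨i / 2, ⟨i % 2, Nat.mod_lt _ (by norm_num)⟩, by omega, by simp; omega⟩
      lift n to ℕ+ using hn
      have h := ((ih n (by have := n.pos; omega) n.pos).const_mul (![α₀, α₁] e)).add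
        (memLp_const (![β₀, β₁] e)) |>.add (hX.memLp_noise hρ n e)
      exact (memLp_congr_ae (hX.daughter e n n.pos)).2 h

/-- Convexity of the square with weights `|a|` and `1 - |a|`, at the points `±x` and `y / (1 -
|a|)`. -/
theorem affine_sq_le {a x y : ℝ} (ha : |a| < 1) :
    (a * x + y) ^ 2 ≤ |a| * x ^ 2 + (1 - |a|)⁻¹ * y ^ 2 := by
  have h : 0 < 1 - |a| := sub_pos.2 ha
  have hkey : (|a| * x ^ 2 + (1 - |a|)⁻¹ * y ^ 2 - (a * x + y) ^ 2) * (1 - |a|) =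
      |a| * (1 - |a|) ^ 2 * x ^ 2 + |a| * y ^ 2 - 2 * (1 - |a|) * (a * x * y) := by
    have h3 : (1 - |a|)⁻¹ * (1 - |a|) = 1 := inv_mul_cancel₀ h.ne'
    linear_combination y ^ 2 * h3 + x ^ 2 * (1 - |a|) * sq_abs a
  have h2 : 0 ≤ |a| * (1 - |a|) ^ 2 * x ^ 2 + |a| * y ^ 2 - 2 * (1 - |a|) * (a * x * y) := by
    rcases abs_cases a with ⟨h', _⟩ | ⟨h', _⟩ <;> rw [h'] at h ⊢
    · nlinarith [mul_nonneg (h' ▸ abs_nonneg a : 0 ≤ a) (sq_nonneg ((1 - a) * x - y))]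
    · nlinarith [mul_nonneg (h' ▸ abs_nonneg a : 0 ≤ -a) (sq_nonneg ((1 - -a) * x + y))]
  rw [← hkey] at h2
  linarith [nonneg_of_mul_nonneg_left h2 h]

theorem integral_daughter_sq_le [IsProbabilityMeasure P] (hX : IsModel P α₀ β₀ α₁ β₁ σ ρ ν ε X)
    (hρ : ρ ∈ Set.Ioo (-1 : ℝ) 1) (hν : Integrable (fun x : ℝ => |x| ^ 2) ν) (n : ℕ+) (e : Fin 2)
    (he : |![α₀, α₁] e| < 1) : ∫ ω, X (2 * n + e) ω ^ 2 ∂P ≤ |![α₀, α₁] e| * ∫ ω, X n ω ^ 2 ∂P +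
      (1 - |![α₀, α₁] e|)⁻¹ * ∫ x, (![β₀, β₁] e + x) ^ 2 ∂gaussianReal 0 (σ ^ 2).toNNReal := by
  have hXn := (hX.memLp_two hρ hν n n.pos).integrable_sq.const_mul |![α₀, α₁] e|
  have hy := (((memLp_const (![β₀, β₁] e)).add (hX.memLp_noise hρ n e)).integrable_sq).const_mul
    (1 - |![α₀, α₁] e|)⁻¹
  have hlaw := (hX.hasLaw_noise hρ n e).integral_comp (f := fun x => (![β₀, β₁] e + x) ^ 2)
    (by fun_prop)
  rw [← hlaw, ← integral_const_mul, ← integral_const_mul]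
  refine le_trans (integral_mono_ae ?_ (hXn.add hy) ?_) (integral_add hXn hy).le
  · refine (hX.memLp_two hρ hν _ ?_).integrable_sq
    have := n.pos
    omega
  · filter_upwards [hX.daughter e n n.pos] with ω hω
    rw [hω, add_assoc]
    exact affine_sq_le he

theorem exists_integral_sq_le [IsProbabilityMeasure P] (hX : IsModel P α₀ β₀ α₁ β₁ σ ρ ν ε X)
    (hρ : ρ ∈ Set.Ioo (-1 : ℝ) 1) (hν : Integrable (fun x : ℝ => |x| ^ 2) ν)
    (hα : ∀ e, |![α₀, α₁] e| < 1) : ∃ M, ∀ i, 1 ≤ i → ∫ ω, X i ω ^ 2 ∂P ≤ M := by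
  set K : Fin 2 → ℝ := fun e => (1 - |![α₀, α₁] e|)⁻¹ *
    ∫ x, (![β₀, β₁] e + x) ^ 2 ∂gaussianReal 0 (σ ^ 2).toNNReal
  -- `B e` is the fixed point of `t ↦ |![α₀, α₁] e| * t + K e`; any level above it is preserved from
  -- mother to daughter.
  set B : Fin 2 → ℝ := fun e => K e / (1 - |![α₀, α₁] e|)
  set M := max (∫ ω, X 1 ω ^ 2 ∂P) (max (B 0) (B 1))
  refine ⟨M, fun i hi => ?_⟩
  induction i using Nat.strong_induction_on with
  | _ i ih =>
    rcases hi.eq_or_lt with rfl | hi1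
    · exact le_max_left _ _
    · obtain ⟨n, e, hn, rfl⟩ : ∃ (n : ℕ) (e : Fin 2), 1 ≤ n ∧ i = 2 * n + e :=
        ⟨i / 2, ⟨i % 2, Nat.mod_lt _ (by norm_num)⟩, by omega, by simp; omega⟩
      lift n to ℕ+ using hn
      have hB : B e ≤ M := by
        refine le_trans ?_ (le_max_right _ _)
        fin_cases e
        · exact le_max_left _ _
        · exact le_max_right _ _
      have h := hX.integral_daughter_sq_le hρ hν n e (hα e)
      have hn := mul_le_mul_of_nonneg_left (ih n (by have := n.pos; omega) n.pos)
        (abs_nonneg (![α₀, α₁] e))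
      have hK : K e ≤ M * (1 - |![α₀, α₁] e|) := (div_le_iff₀ (sub_pos.2 (hα e))).1 hB
      change _ ≤ _ + K e at h
      linarith

theorem ae_tendsto_avg_noise [IsProbabilityMeasure P] (hX : IsModel P α₀ β₀ α₁ β₁ σ ρ ν ε X)
    (hρ : ρ ∈ Set.Ioo (-1 : ℝ) 1) (e : Fin 2) :
    ∀ᵐ ω ∂P, Tendsto (fun r => avg r fun i => ε (2 * i + e) ω) atTop (𝓝 0) := by
  have h := hX.tendsto_avg_mul_noise hρ (A := fun _ _ => 1) (M := 1) (fun _ _ => memLp_const 1)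
    (by simp) (fun _ _ _ _ => aestronglyMeasurable_const) (h := fun x => x) measurable_id
    (memLp_id_gaussianReal 2) (by simp) e
  simpa only [one_mul] using h

theorem ae_tendsto_avg_noise_sq [IsProbabilityMeasure P] (hX : IsModel P α₀ β₀ α₁ β₁ σ ρ ν ε X)
    (hρ : ρ ∈ Set.Ioo (-1 : ℝ) 1) (e : Fin 2) :
    ∀ᵐ ω ∂P, Tendsto (fun r => avg r fun i => ε (2 * i + e) ω ^ 2) atTop (𝓝 (σ ^ 2)) := by
  have hσ : ((σ ^ 2).toNNReal : ℝ) = σ ^ 2 := Real.coe_toNNReal _ (sq_nonneg σ)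
  have hLp := memLp_sq_gaussianReal (σ ^ 2).toNNReal
  -- The function `h` is the square centered at its mean; it lies in `L²` by finiteness of the
  -- Gaussian fourth moment.
  have h := hX.tendsto_avg_mul_noise hρ (A := fun _ _ => 1) (M := 1) (fun _ _ => memLp_const 1)
    (by simp) (fun _ _ _ _ => aestronglyMeasurable_const) (h := fun x => x ^ 2 + -σ ^ 2)
    (by fun_prop) (hLp.add (memLp_const _)) (by
      rw [integral_add (hLp.integrable one_le_two) (integrable_const _),
        integral_sq_gaussianReal, hσ]
      simp) e
  filter_upwards [h] with ω hω
  simp only [one_mul, avg_add, avg_const] at hω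
  have h := hω.add_const (σ ^ 2)
  rw [zero_add] at h
  exact h.congr fun r => by ring

end IsModel
end BAR

theorem proposition31 {Ω : Type*} [MeasurableSpace Ω] (P : Measure Ω) [IsProbabilityMeasure P]
    (α₀ β₀ α₁ β₁ σ ρ : ℝ)
    (hα₀ : α₀ ∈ Set.Ioo (-1 : ℝ) 1) (hα₁ : α₁ ∈ Set.Ioo (-1 : ℝ) 1)
    (hσ : 0 < σ) (hρ : ρ ∈ Set.Ioo (-1 : ℝ) 1)
    (ν : Measure ℝ) (hν : ∀ k : ℕ, Integrable (fun x : ℝ => |x| ^ k) ν)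
    (ε X : ℕ → Ω → ℝ) (hX : BAR.IsModel P α₀ β₀ α₁ β₁ σ ρ ν ε X) :
    ∀ᵐ ω ∂P, Tendsto (fun r : ℕ => BAR.thetaHat (fun n => X n ω) r) atTop
      (𝓝 (α₀, β₀, α₁, β₁)) := by
  have hα : ∀ e, |![α₀, α₁] e| < 1 := Fin.forall_fin_two.2 ⟨abs_lt.2 hα₀, abs_lt.2 hα₁⟩
  obtain ⟨M, hM⟩ := hX.exists_integral_sq_le hρ (hν 2) hα
  have hxu : ∀ e : Fin 2, ∀ᵐ ω ∂P,
      Tendsto (fun r => BAR.avg r fun i => X i ω * ε (2 * i + e) ω) atTop (𝓝 0) :=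
    hX.tendsto_avg_mul_noise hρ (hX.memLp_two hρ (hν 2)) hM hX.aestronglyMeasurable_past
      (h := fun x => x) measurable_id (memLp_id_gaussianReal 2) (by simp)
  have hx : ∀ᵐ ω ∂P, ∀ e : Fin 2, ∀ i, 1 ≤ i →
      X (2 * i + e) ω = ![α₀, α₁] e * X i ω + ![β₀, β₁] e + ε (2 * i + e) ω := by
    simp_rw [ae_all_iff]
    exact hX.daughter
  filter_upwards [hx, ae_all_iff.2 (hX.ae_tendsto_avg_noise hρ),
    ae_all_iff.2 (hX.ae_tendsto_avg_noise_sq hρ), ae_all_iff.2 hxu] with ω hx hu hu2 hxu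
  have h := BAR.tendsto_alphaHat_betaHat (x := fun n => X n ω) (u := fun n => ε n ω) hα
    (pow_pos hσ 2) hx hu hu2 hxu
  exact (h 0).1.prodMk_nhds ((h 0).2.prodMk_nhds ((h 1).1.prodMk_nhds (h 1).2))
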